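/- Let $p,q$ be real numbers with $1\le p,q\le 2$ and $\frac1p+\frac1q\le\frac32$. Let $c_0$ be the Banach space of real null sequences $x=(x_k)_{k\ge1}$ with the supremum norm, let $(e_k)_{k\ge1}$ be its canonical unit vectors, and for a continuous bilinear form $A:c_0\times c_0\to\mathbb R$ let $\|A\|=\sup\{|A(x,y)|:\|x\|\le1,\ \|y\|\le1\}$. Then for every continuous bilinear form $A:c_0\times c_0\to\mathbb R$ $$\Bigl(\sum_{k=1}^\infty\Bigl(\sum_{j=1}^\infty|A(e_k,e_j)|^q\Bigr)^{p/q}\Bigr)^{1/p}\le 2^{\frac1p+\frac1q-1}\|A\|,$$ where in particular all the series converge. Moreover, the constant $2^{\frac1p+\frac1q-1}$ is optimal: if $C\in\mathbb R$ is such that the left-hand side is at most $C\|A\|$ for every continuous bilinear form $A:c_0\times c_0\to\mathbb R$, then $C\ge 2^{\frac1p+\frac1q-1}$. In fact, the form $A(x,y)=x_1y_1+x_1y_2+x_2y_1-x_2y_2$ has $\|A\|=2$ and attains equality in the inequality. -/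

import Mathlib

open scoped ZeroAtInfty ENNReal

noncomputable section

/-- The real Banach space `c₀` of null sequences with the supremum norm: the functions on the
discrete space `ℕ` that vanish at infinity. The coordinates are numbered from `0`. -/
def CZero : Type := C₀(ℕ, ℝ)

instance : NormedAddCommGroup CZero := inferInstanceAs (NormedAddCommGroup C₀(ℕ, ℝ))

instance : NormedSpace ℝ CZero := inferInstanceAs (NormedSpace ℝ C₀(ℕ, ℝ))

instance : FunLike CZero ℕ ℝ := inferInstanceAs (FunLike C₀(ℕ, ℝ) ℕ ℝ)

/-- The `k`-th canonical unit vector of `c₀`. -/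
def CZero.e (k : ℕ) : CZero := show C₀(ℕ, ℝ) from {
  toFun := Pi.single k 1
  continuous_toFun := continuous_of_discreteTopology
  zero_at_infty' := by
    rw [Filter.cocompact_eq_cofinite]
    refine tendsto_const_nhds.congr' ?_
    have h : ∀ᶠ n in Filter.cofinite, n ≠ k := by
      simp [Filter.eventually_cofinite]
    filter_upwards [h] with n hn
    simp [Pi.single_eq_of_ne hn] }

/-- The mixed sum `(∑ₖ (∑ⱼ |A(eₖ, eⱼ)|^q)^(p/q))^(1/p)` of a continuous bilinear form on
`c₀ × c₀`. It is computed in `[0, ∞]`, so that it is finite only if the series converge. -/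
def mixedSum (p q : ℝ) (A : CZero →L[ℝ] CZero →L[ℝ] ℝ) : ℝ≥0∞ :=
  (∑' k : ℕ, (∑' j : ℕ, ENNReal.ofReal |A (CZero.e k) (CZero.e j)| ^ q) ^ (p / q)) ^ (1 / p)

end

/-! The point (1/p, 1/q) lies in the triangle with vertices (1/2, 1/2), (1, 1/2), (1/2, 1), so
Hölder reduces the claim for finite matrices to the exponents (2, 2), (1, 2), (2, 1). There the
constants are 1, √2, √2; the last two carry the weights 2/p - 1 and 2/q - 1, whence 2^(1/p + 1/q -
1).

Evaluating the form at sign vectors bounds the ℓ¹ norm of signed sums of rows or columns. Averaging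
over signs gives (2, 2) by orthogonality and (1, 2) by `khinchine_one`; Minkowski applied to the
transpose gives (2, 1). The sharp √2 comes from the Latała–Oleszkiewicz argument: the modulus of a
Rademacher sum is even, so it has the doubled spectral gap of `cube_poincare_even`, while its energy
is at most that of the sum itself. Truncation passes to c₀. -/

/-! ### Poincaré inequalities on the discrete cube -/

/-- The Dirichlet form of a function on the discrete cube (up to normalization). -/
def cubeEnergy {n : ℕ} (f : (Fin n → Bool) → ℝ) : ℝ :=
  ∑ ε, ∑ i, (f ε - f (Function.update ε i (!ε i))) ^ 2

theorem sum_cube_succ {n : ℕ} (f : (Fin (n + 1) → Bool) → ℝ) :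
    ∑ ε, f ε = ∑ ε : Fin n → Bool, (f (Fin.cons false ε) + f (Fin.cons true ε)) := by
  rw [← (Fin.consEquiv (fun _ : Fin (n + 1) => Bool)).sum_comp, Fintype.sum_prod_type]
  simp only [Fintype.sum_bool, Finset.sum_add_distrib]
  exact add_comm _ _

/-- The factor 2 arises because each edge is counted from both endpoints. -/
theorem cubeEnergy_succ {n : ℕ} (f : (Fin (n + 1) → Bool) → ℝ) :
    cubeEnergy f = cubeEnergy (fun ε => f (Fin.cons false ε)) +
      cubeEnergy (fun ε => f (Fin.cons true ε)) +
      2 * ∑ ε : Fin n → Bool, (f (Fin.cons false ε) - f (Fin.cons true ε)) ^ 2 := by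
  unfold cubeEnergy
  rw [sum_cube_succ, Finset.mul_sum, ← Finset.sum_add_distrib, ← Finset.sum_add_distrib]
  refine Finset.sum_congr rfl fun ε _ => ?_
  simp only [Fin.sum_univ_succ, Fin.cons_zero, Fin.cons_succ, Fin.update_cons_zero,
    ← Fin.cons_update, Bool.not_false, Bool.not_true]
  ring

theorem cube_card (n : ℕ) : ((Finset.univ : Finset (Fin n → Bool)).card : ℝ) = 2 ^ n := by
  simp

/-- The Poincaré inequality on the discrete cube. -/
theorem cube_poincare {n : ℕ} (f : (Fin n → Bool) → ℝ) :
    4 * (2 ^ n * ∑ ε, f ε ^ 2 - (∑ ε, f ε) ^ 2) ≤ 2 ^ n * cubeEnergy f := by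
  induction n with
  | zero => simp [cubeEnergy]
  | succ n ih =>
    have h0 := ih (fun ε => f (Fin.cons false ε))
    have h1 := ih (fun ε => f (Fin.cons true ε))
    have h2 := sq_sum_le_card_mul_sum_sq (s := Finset.univ)
      (f := fun ε : Fin n → Bool => f (Fin.cons false ε) - f (Fin.cons true ε))
    rw [cube_card, Finset.sum_sub_distrib] at h2
    rw [cubeEnergy_succ, sum_cube_succ, sum_cube_succ, Finset.sum_add_distrib,
      Finset.sum_add_distrib, pow_succ]
    linarith

/-- The Poincaré inequality for even functions on the discrete cube, where the spectral gap
doubles. -/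
theorem cube_poincare_even {n : ℕ} (f : (Fin n → Bool) → ℝ)
    (hf : ∀ ε, f (fun i => !ε i) = f ε) :
    8 * (2 ^ n * ∑ ε, f ε ^ 2 - (∑ ε, f ε) ^ 2) ≤ 2 ^ n * cubeEnergy f := by
  induction n with
  | zero => simp [cubeEnergy]
  | succ n ih =>
    have key : ∀ ε : Fin n → Bool, f (Fin.cons false fun i => !ε i) = f (Fin.cons true ε) := by
      intro ε
      rw [← hf (Fin.cons true ε)]
      congr 1
      funext i
      refine Fin.cases ?_ (fun j => ?_) i <;> simp
    have key' : ∀ ε : Fin n → Bool, f (Fin.cons true fun i => !ε i) = f (Fin.cons false ε) := by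
      intro ε
      rw [← key]
      simp
    -- Negation swaps the two half-cubes, so the sum of the two restrictions is even, to which
    -- induction applies, and their difference has mean zero. The difference needs only the gap 4:
    -- the edges between the halves supply the other 4.
    let neg : (Fin n → Bool) ≃ (Fin n → Bool) :=
      ⟨fun ε i => !ε i, fun ε i => !ε i, fun ε => by simp, fun ε => by simp⟩
    have hs : ∑ ε : Fin n → Bool, f (Fin.cons false ε) = ∑ ε : Fin n → Bool, f (Fin.cons true ε) := by
      rw [← neg.sum_comp]
      exact Finset.sum_congr rfl fun ε _ => key ε
    have hu := ih (fun ε => f (Fin.cons false ε) + f (Fin.cons true ε)) (fun ε => by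
      rw [key, key', add_comm])
    have hv := cube_poincare (fun ε : Fin n → Bool => f (Fin.cons false ε) - f (Fin.cons true ε))
    have hE : cubeEnergy (fun ε : Fin n → Bool => f (Fin.cons false ε) + f (Fin.cons true ε)) +
        cubeEnergy (fun ε : Fin n → Bool => f (Fin.cons false ε) - f (Fin.cons true ε)) =
        2 * cubeEnergy (fun ε => f (Fin.cons false ε)) +
          2 * cubeEnergy (fun ε => f (Fin.cons true ε)) := by
      simp only [cubeEnergy, Finset.mul_sum, ← Finset.sum_add_distrib]
      refine Finset.sum_congr rfl fun ε _ => Finset.sum_congr rfl fun i _ => ?_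
      ring
    have hS : ∑ ε : Fin n → Bool, (f (Fin.cons false ε) + f (Fin.cons true ε)) ^ 2 +
        ∑ ε : Fin n → Bool, (f (Fin.cons false ε) - f (Fin.cons true ε)) ^ 2 =
        2 * ∑ ε : Fin n → Bool, (f (Fin.cons false ε) ^ 2 + f (Fin.cons true ε) ^ 2) := by
      simp only [Finset.mul_sum, ← Finset.sum_add_distrib]
      refine Finset.sum_congr rfl fun ε _ => ?_
      ring
    rw [Finset.sum_sub_distrib, hs, sub_self] at hv
    rw [cubeEnergy_succ, sum_cube_succ, sum_cube_succ, pow_succ]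
    generalize ∑ ε : Fin n → Bool, (f (Fin.cons false ε) + f (Fin.cons true ε)) = s at *
    have hS' : ∑ ε : Fin n → Bool, (f (Fin.cons false ε) ^ 2 + f (Fin.cons true ε) ^ 2) =
      (∑ ε : Fin n → Bool, (f (Fin.cons false ε) + f (Fin.cons true ε)) ^ 2 +
        ∑ ε : Fin n → Bool, (f (Fin.cons false ε) - f (Fin.cons true ε)) ^ 2) / 2 := by linarith
    have hE' := congrArg (fun x : ℝ => 2 ^ n * x) hE
    rw [hS']
    linarith

/-! ### Rademacher sums and Khinchine's inequality -/

/-- The sign `±1` attached to a Boolean. -/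
def boolSign (b : Bool) : ℝ := if b then 1 else -1

theorem boolSign_not (b : Bool) : boolSign (!b) = -boolSign b := by
  cases b <;> simp [boolSign]

theorem abs_boolSign (b : Bool) : |boolSign b| = 1 := by
  cases b <;> simp [boolSign]

/-- The variance of a Rademacher sum. -/
theorem sum_sq_rademacher {n : ℕ} (a : Fin n → ℝ) :
    ∑ ε : Fin n → Bool, (∑ j, boolSign (ε j) * a j) ^ 2 = 2 ^ n * ∑ j, a j ^ 2 := by
  induction n with
  | zero => simp
  | succ n ih =>
    have h := ih (fun j => a j.succ)
    rw [sum_cube_succ]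
    simp only [Fin.sum_univ_succ, Fin.cons_zero, Fin.cons_succ]
    calc _ = ∑ ε : Fin n → Bool, (2 * a 0 ^ 2 + 2 * (∑ j, boolSign (ε j) * a j.succ) ^ 2) := by
          refine Finset.sum_congr rfl fun ε _ => ?_
          simp only [boolSign]
          simp only [if_true, Bool.false_eq_true, if_false]
          ring
      _ = _ := by
          rw [Finset.sum_add_distrib, ← Finset.mul_sum (a := (2 : ℝ))
              (f := fun ε : Fin n → Bool => (∑ j, boolSign (ε j) * a j.succ) ^ 2), h, Finset.sum_const,
            Finset.card_univ, nsmul_eq_mul]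
          simp
          ring

theorem rademacher_update {n : ℕ} (a : Fin n → ℝ) (ε : Fin n → Bool) (i : Fin n) :
    ∑ j, boolSign (Function.update ε i (!ε i) j) * a j =
      (∑ j, boolSign (ε j) * a j) - 2 * (boolSign (ε i) * a i) := by
  have : ∀ j, boolSign (Function.update ε i (!ε i) j) * a j =
      boolSign (ε j) * a j - if i = j then 2 * (boolSign (ε i) * a i) else 0 := by
    intro j
    by_cases h : i = j
    · subst h
      simp [boolSign_not]
      ring
    · simp [h, Function.update_of_ne (Ne.symm h)]
  simp [this]

/-- A Rademacher sum is an eigenfunction: its values at the n neighbours of a vertex add up to n - 2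
times its value there. The triangle inequality makes this an inequality for the modulus, and
expanding the squares gives n + n - 2(n - 2) = 4. -/
theorem cubeEnergy_abs_rademacher_le {n : ℕ} (a : Fin n → ℝ) :
    cubeEnergy (fun ε : Fin n → Bool => |∑ j, boolSign (ε j) * a j|) ≤
      4 * ∑ ε : Fin n → Bool, |∑ j, boolSign (ε j) * a j| ^ 2 := by
  set f : (Fin n → Bool) → ℝ := fun ε => |∑ j, boolSign (ε j) * a j| with hf
  have hpt : ∀ ε, ((n : ℝ) - 2) * f ε ≤ ∑ i, f (Function.update ε i (!ε i)) := by
    intro ε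
    have h1 : ∑ i : Fin n, ∑ j, boolSign (Function.update ε i (!ε i) j) * a j =
        ((n : ℝ) - 2) * ∑ j, boolSign (ε j) * a j := by
      simp only [rademacher_update, Finset.sum_sub_distrib, ← Finset.mul_sum]
      simp
      ring
    calc ((n : ℝ) - 2) * f ε ≤ |((n : ℝ) - 2) * ∑ j, boolSign (ε j) * a j| := by
          rw [abs_mul]
          exact mul_le_mul_of_nonneg_right (le_abs_self _) (abs_nonneg _)
      _ ≤ _ := by
          rw [← h1]
          exact Finset.abs_sum_le_sum_abs _ _
  have hflip : ∀ i : Fin n, ∑ ε, f (Function.update ε i (!ε i)) ^ 2 = ∑ ε, f ε ^ 2 := by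
    intro i
    have hinv : Function.Involutive (fun ε : Fin n → Bool => Function.update ε i (!ε i)) := by
      intro ε
      simp
    exact Equiv.sum_comp (hinv.toPerm _) (fun ε => f ε ^ 2)
  have hexp : cubeEnergy f = ∑ ε, (n * f ε ^ 2) + ∑ i : Fin n, ∑ ε, f (Function.update ε i (!ε i)) ^ 2 -
      2 * ∑ ε, f ε * ∑ i, f (Function.update ε i (!ε i)) := by
    rw [Finset.sum_comm (γ := Fin n)]
    unfold cubeEnergy
    rw [Finset.mul_sum, ← Finset.sum_add_distrib, ← Finset.sum_sub_distrib]
    refine Finset.sum_congr rfl fun ε _ => ?_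
    have hn : (n : ℝ) * f ε ^ 2 = ∑ _i : Fin n, f ε ^ 2 := by simp
    rw [hn, Finset.mul_sum, Finset.mul_sum, ← Finset.sum_add_distrib, ← Finset.sum_sub_distrib]
    refine Finset.sum_congr rfl fun i _ => ?_
    ring
  have hcross : ((n : ℝ) - 2) * ∑ ε, f ε ^ 2 ≤ ∑ ε, f ε * ∑ i, f (Function.update ε i (!ε i)) := by
    rw [Finset.mul_sum]
    refine Finset.sum_le_sum fun ε _ => ?_
    have := mul_le_mul_of_nonneg_left (hpt ε) (abs_nonneg _ : 0 ≤ f ε)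
    linarith
  rw [hexp]
  simp only [hflip, ← Finset.mul_sum]
  simp only [Finset.sum_const, Finset.card_univ, Fintype.card_fin, nsmul_eq_mul]
  linarith

/-- The Khinchine inequality between `L²` and `L¹` with its best constant `√2`. -/
theorem khinchine_one {n : ℕ} (a : Fin n → ℝ) :
    2 ^ n * √(∑ j, a j ^ 2) ≤ √2 * ∑ ε : Fin n → Bool, |∑ j, boolSign (ε j) * a j| := by
  have h1 := cube_poincare_even (fun ε : Fin n → Bool => |∑ j, boolSign (ε j) * a j|) (fun ε => by
    simp [boolSign_not])
  have h2 := mul_le_mul_of_nonneg_left (cubeEnergy_abs_rademacher_le a)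
    (by positivity : (0 : ℝ) ≤ 2 ^ n)
  simp only [sq_abs, sum_sq_rademacher] at h1 h2
  have h0 : 0 ≤ ∑ ε : Fin n → Bool, |∑ j, boolSign (ε j) * a j| :=
    Finset.sum_nonneg fun _ _ => abs_nonneg _
  -- The gap 8 against the energy constant 4 leaves 2^n ∑ f² ≤ 2 (∑ f)².
  refine le_of_sq_le_sq ?_ (by positivity)
  rw [mul_pow, mul_pow, Real.sq_sqrt (Finset.sum_nonneg fun _ _ => sq_nonneg _),
    Real.sq_sqrt (by norm_num)]
  nlinarith

/-! ### The three endpoint inequalities -/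

/-- Endpoint `(2, 2)`. -/
theorem sum_sum_sq_le {m n : ℕ} (a : Fin m → Fin n → ℝ) {M : ℝ}
    (h : ∀ ε : Fin n → Bool, ∑ k, |∑ j, boolSign (ε j) * a k j| ≤ M) :
    ∑ k, ∑ j, a k j ^ 2 ≤ M ^ 2 := by
  have h1 : 2 ^ n * ∑ k, ∑ j, a k j ^ 2 ≤ 2 ^ n * M ^ 2 := by
    rw [Finset.mul_sum, Finset.sum_congr rfl fun k _ => (sum_sq_rademacher (a k)).symm,
      Finset.sum_comm]
    calc _ ≤ ∑ _ε : Fin n → Bool, M ^ 2 := by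
          refine Finset.sum_le_sum fun ε _ => ?_
          calc _ = ∑ k, |∑ j, boolSign (ε j) * a k j| ^ 2 := by simp only [sq_abs]
            _ ≤ (∑ k, |∑ j, boolSign (ε j) * a k j|) ^ 2 :=
                Finset.sum_sq_le_sq_sum_of_nonneg fun _ _ => abs_nonneg _
            _ ≤ M ^ 2 := pow_le_pow_left₀ (Finset.sum_nonneg fun _ _ => abs_nonneg _) (h ε) 2
      _ = _ := by simp
  exact le_of_mul_le_mul_left h1 (by positivity)

/-- Endpoint `(1, 2)`, the mixed Littlewood inequality. -/
theorem sum_sqrt_sum_sq_le {m n : ℕ} (a : Fin m → Fin n → ℝ) {M : ℝ}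
    (h : ∀ ε : Fin n → Bool, ∑ k, |∑ j, boolSign (ε j) * a k j| ≤ M) :
    ∑ k, √(∑ j, a k j ^ 2) ≤ √2 * M := by
  have h1 : 2 ^ n * ∑ k, √(∑ j, a k j ^ 2) ≤ 2 ^ n * (√2 * M) := by
    rw [Finset.mul_sum]
    calc _ ≤ ∑ k, √2 * ∑ ε : Fin n → Bool, |∑ j, boolSign (ε j) * a k j| :=
          Finset.sum_le_sum fun k _ => khinchine_one (a k)
      _ = √2 * ∑ ε : Fin n → Bool, ∑ k, |∑ j, boolSign (ε j) * a k j| := by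
          rw [← Finset.mul_sum, Finset.sum_comm]
      _ ≤ √2 * ∑ _ε : Fin n → Bool, M := by gcongr with ε; exact h ε
      _ = _ := by simp; ring
  exact le_of_mul_le_mul_left h1 (by positivity)

/-- Minkowski's inequality for the mixed norms with exponents `(2, 1)` and `(1, 2)`. -/
theorem sqrt_sum_sq_sum_abs_le {m n : ℕ} (a : Fin m → Fin n → ℝ) :
    √(∑ k, (∑ j, |a k j|) ^ 2) ≤ ∑ j, √(∑ k, a k j ^ 2) := by
  have h := norm_sum_le Finset.univ
    (fun j => (WithLp.toLp 2 fun k => |a k j| : EuclideanSpace ℝ (Fin m)))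
  simpa [EuclideanSpace.norm_eq] using h

/-- Endpoint `(2, 1)`. -/
theorem sum_sq_sum_abs_le {m n : ℕ} (a : Fin m → Fin n → ℝ) {M : ℝ}
    (h : ∀ ε : Fin m → Bool, ∑ j, |∑ k, boolSign (ε k) * a k j| ≤ M) :
    ∑ k, (∑ j, |a k j|) ^ 2 ≤ 2 * M ^ 2 := by
  have h1 := (sqrt_sum_sq_sum_abs_le a).trans (sum_sqrt_sum_sq_le (fun j k => a k j) h)
  have h2 := (Real.sqrt_le_left (Real.sqrt_nonneg _ |>.trans h1)).1 h1
  rwa [mul_pow, Real.sq_sqrt (by norm_num)] at h2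

/-! ### Interpolation between the endpoints -/

/-- Hölder's inequality for finite sums of weighted products. -/
theorem ENNReal.sum_prod_rpow_le {m : ℕ} {ι : Type*} [Fintype ι] (f : ι → Fin m → ℝ≥0∞)
    (w : ι → ℝ) (hw : ∑ l, w l = 1) (hw0 : ∀ l, 0 ≤ w l) :
    ∑ i, ∏ l, f l i ^ w l ≤ ∏ l, (∑ i, f l i) ^ w l := by
  have h := ENNReal.lintegral_prod_norm_pow_le (μ := (MeasureTheory.Measure.count : MeasureTheory.Measure (Fin m)))
    Finset.univ (f := f) (fun _ _ => (measurable_of_finite _).aemeasurable) hw (fun l _ => hw0 l)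
  simpa [MeasureTheory.lintegral_count] using h

theorem ENNReal.sum_mixed_rpow_le {m n : ℕ} (b : Fin m → Fin n → ℝ≥0∞) {p q : ℝ} (hp1 : 1 ≤ p)
    (hp2 : p ≤ 2) (hq1 : 1 ≤ q) (hq2 : q ≤ 2) (hpq : 1 / p + 1 / q ≤ 3 / 2) :
    ∑ k, (∑ j, b k j ^ q) ^ (p / q) ≤
      (∑ k, (∑ j, b k j) ^ (2 : ℝ)) ^ (p / q - p / 2) *
        (∑ k, (∑ j, b k j ^ (2 : ℝ)) ^ (1 / 2 : ℝ)) ^ (2 - p) *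
        (∑ k, ∑ j, b k j ^ (2 : ℝ)) ^ (3 / 2 * p - 1 - p / q) := by
  have hp : 0 < p := by linarith
  have hq : 0 < q := by linarith
  have hα : 0 ≤ p / q - p / 2 := by
    have := div_le_div_of_nonneg_left hp.le hq hq2
    linarith
  have hγ : 0 ≤ 3 / 2 * p - 1 - p / q := by
    have := mul_le_mul_of_nonneg_left hpq hp.le
    rw [mul_add, mul_one_div_cancel hp.ne', mul_one_div] at this
    linarith
  -- Interpolation of ℓ^q between ℓ¹ and ℓ² in each row; the three-factor Hölder over the rows
  -- follows.
  have inner : ∀ k, ∑ j, b k j ^ q ≤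
      (∑ j, b k j) ^ (2 - q) * (∑ j, b k j ^ (2 : ℝ)) ^ (q - 1) := by
    intro k
    have h := ENNReal.sum_prod_rpow_le ![b k, fun j => b k j ^ (2 : ℝ)] ![2 - q, q - 1]
      (by simp [Fin.sum_univ_two]; norm_num) (by
        intro l
        fin_cases l
        · simpa using hq2
        · simpa using hq1)
    simp only [Fin.prod_univ_two, Matrix.cons_val_zero, Matrix.cons_val_one] at h
    refine le_trans (le_of_eq (Finset.sum_congr rfl fun j _ => ?_)) h
    rw [← ENNReal.rpow_mul, ← ENNReal.rpow_add_of_nonneg _ _ (by linarith) (by linarith)]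
    congr 1
    ring
  have h := ENNReal.sum_prod_rpow_le
    ![fun k => (∑ j, b k j) ^ (2 : ℝ), fun k => (∑ j, b k j ^ (2 : ℝ)) ^ (1 / 2 : ℝ),
      fun k => ∑ j, b k j ^ (2 : ℝ)] ![p / q - p / 2, 2 - p, 3 / 2 * p - 1 - p / q]
    (by simp [Fin.sum_univ_three]; ring) (by
      intro l
      fin_cases l
      · simpa using hα
      · simpa using hp2
      · simpa using hγ)
  simp only [Fin.prod_univ_three, Matrix.cons_val_zero, Matrix.cons_val_one,
    Matrix.cons_val_two, Matrix.tail_cons, Matrix.head_cons] at h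
  refine le_trans (Finset.sum_le_sum fun k _ => ?_) h
  refine (ENNReal.rpow_le_rpow (inner k) (by positivity)).trans (le_of_eq ?_)
  rw [ENNReal.mul_rpow_of_nonneg _ _ (by positivity), ← ENNReal.rpow_mul, ← ENNReal.rpow_mul,
    ← ENNReal.rpow_mul, ← ENNReal.rpow_mul, mul_assoc,
    ← ENNReal.rpow_add_of_nonneg _ _ (by linarith) hγ]
  congr 2
  · field_simp
  · field_simp
    ring

/-- The finite-dimensional form of the inequality. -/
theorem sum_mixed_le {m n : ℕ} (a : Fin m → Fin n → ℝ) {M : ℝ} (hM : 0 ≤ M)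
    (h : ∀ ε : Fin n → Bool, ∑ k, |∑ j, boolSign (ε j) * a k j| ≤ M)
    (h' : ∀ ε : Fin m → Bool, ∑ j, |∑ k, boolSign (ε k) * a k j| ≤ M)
    {p q : ℝ} (hp1 : 1 ≤ p) (hp2 : p ≤ 2) (hq1 : 1 ≤ q) (hq2 : q ≤ 2)
    (hpq : 1 / p + 1 / q ≤ 3 / 2) :
    ∑ k, (∑ j, ENNReal.ofReal |a k j| ^ q) ^ (p / q) ≤
      ENNReal.ofReal ((2 : ℝ) ^ (1 / p + 1 / q - 1) * M) ^ p := by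
  have hp : 0 < p := by linarith
  have hq : 0 < q := by linarith
  have hα : 0 ≤ p / q - p / 2 := by
    have := div_le_div_of_nonneg_left hp.le hq hq2
    linarith
  have hγ : 0 ≤ 3 / 2 * p - 1 - p / q := by
    have := mul_le_mul_of_nonneg_left hpq hp.le
    rw [mul_add, mul_one_div_cancel hp.ne', mul_one_div] at this
    linarith
  have hS : ∀ k, ∑ j, ENNReal.ofReal |a k j| ^ (2 : ℝ) = ENNReal.ofReal (∑ j, a k j ^ 2) := by
    intro k
    rw [ENNReal.ofReal_sum_of_nonneg fun _ _ => sq_nonneg _]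
    refine Finset.sum_congr rfl fun j _ => ?_
    rw [ENNReal.ofReal_rpow_of_nonneg (abs_nonneg _) (by norm_num), Real.rpow_two, sq_abs]
  have e1 : ∑ k, (∑ j, ENNReal.ofReal |a k j|) ^ (2 : ℝ) ≤ ENNReal.ofReal (2 * M ^ 2) := by
    refine le_trans (le_of_eq ?_) (ENNReal.ofReal_le_ofReal (sum_sq_sum_abs_le a h'))
    rw [ENNReal.ofReal_sum_of_nonneg fun _ _ => sq_nonneg _]
    refine Finset.sum_congr rfl fun k _ => ?_
    have h0 : 0 ≤ ∑ j, |a k j| := Finset.sum_nonneg fun _ _ => abs_nonneg _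
    rw [← ENNReal.ofReal_sum_of_nonneg fun _ _ => abs_nonneg _,
      ENNReal.ofReal_rpow_of_nonneg h0 (by norm_num), Real.rpow_two]
  have e2 : ∑ k, (∑ j, ENNReal.ofReal |a k j| ^ (2 : ℝ)) ^ (1 / 2 : ℝ) ≤
      ENNReal.ofReal (√2 * M) := by
    refine le_trans (le_of_eq ?_) (ENNReal.ofReal_le_ofReal (sum_sqrt_sum_sq_le a h))
    rw [ENNReal.ofReal_sum_of_nonneg fun _ _ => Real.sqrt_nonneg _]
    refine Finset.sum_congr rfl fun k _ => ?_
    rw [hS, ENNReal.ofReal_rpow_of_nonneg (Finset.sum_nonneg fun _ _ => sq_nonneg _)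
      (by norm_num), Real.sqrt_eq_rpow]
  have e3 : ∑ k, ∑ j, ENNReal.ofReal |a k j| ^ (2 : ℝ) ≤ ENNReal.ofReal (M ^ 2) := by
    simp only [hS]
    rw [← ENNReal.ofReal_sum_of_nonneg fun _ _ => Finset.sum_nonneg fun _ _ => sq_nonneg _]
    exact ENNReal.ofReal_le_ofReal (sum_sum_sq_le a h)
  refine (ENNReal.sum_mixed_rpow_le (fun k j => ENNReal.ofReal |a k j|) hp1 hp2 hq1 hq2
    hpq).trans ?_
  refine (mul_le_mul' (mul_le_mul' (ENNReal.rpow_le_rpow e1 hα)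
    (ENNReal.rpow_le_rpow e2 (by linarith))) (ENNReal.rpow_le_rpow e3 hγ)).trans (le_of_eq ?_)
  rw [ENNReal.ofReal_rpow_of_nonneg (by positivity) hα,
    ENNReal.ofReal_rpow_of_nonneg (by positivity) (by linarith),
    ENNReal.ofReal_rpow_of_nonneg (by positivity) hγ,
    ENNReal.ofReal_rpow_of_nonneg (by positivity) hp.le,
    ← ENNReal.ofReal_mul (by positivity), ← ENNReal.ofReal_mul (by positivity)]
  congr 1
  rw [Real.sqrt_eq_rpow, ← Real.rpow_two, Real.mul_rpow (by norm_num) (by positivity),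
    Real.mul_rpow (by positivity) hM, Real.mul_rpow (by positivity) hM, ← Real.rpow_mul hM,
    ← Real.rpow_mul hM, ← Real.rpow_mul (by norm_num), ← Real.rpow_mul (by norm_num)]
  calc _ = ((2 : ℝ) ^ (p / q - p / 2) * 2 ^ (1 / 2 * (2 - p))) *
        (M ^ (2 * (p / q - p / 2)) * M ^ (2 - p) * M ^ (2 * (3 / 2 * p - 1 - p / q))) := by ring
    _ = _ := by
      rw [← Real.rpow_add (by norm_num), ← Real.rpow_add_of_nonneg hM (by linarith) (by linarith),
        ← Real.rpow_add_of_nonneg hM (by linarith) (by linarith)]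
      congr 2
      · field_simp
        ring
      · ring

/-! ### Bilinear forms on c₀ and the extremal form -/

namespace CZero

theorem abs_apply_le_norm (x : CZero) (k : ℕ) : |x k| ≤ ‖x‖ := by
  have h := BoundedContinuousFunction.norm_coe_le_norm
    (ZeroAtInftyContinuousMap.toBCF (show C₀(ℕ, ℝ) from x)) k
  rw [ZeroAtInftyContinuousMap.norm_toBCF_eq_norm] at h
  exact h

theorem norm_le {x : CZero} {C : ℝ} (hC : 0 ≤ C) (h : ∀ k, |x k| ≤ C) : ‖x‖ ≤ C := by
  have h' := (BoundedContinuousFunction.norm_le hC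
    (f := ZeroAtInftyContinuousMap.toBCF (show C₀(ℕ, ℝ) from x))).2 h
  rw [ZeroAtInftyContinuousMap.norm_toBCF_eq_norm] at h'
  exact h'

theorem e_apply (k i : ℕ) : e k i = if i = k then 1 else 0 :=
  Pi.single_apply k (1 : ℝ) i

/-- The coordinate functionals of `c₀`. -/
noncomputable def coord (k : ℕ) : CZero →L[ℝ] ℝ :=
  LinearMap.mkContinuous
    { toFun := fun x : CZero => x k
      map_add' := fun _ _ => rfl
      map_smul' := fun _ _ => rfl } 1 (fun x => by
        rw [one_mul]
        exact abs_apply_le_norm x k)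

theorem coord_apply (k : ℕ) (x : CZero) : coord k x = x k := rfl

theorem add_apply (x y : CZero) (k : ℕ) : (x + y) k = x k + y k := rfl

theorem norm_sum_smul_e_le {m : ℕ} (c : Fin m → ℝ) (hc : ∀ k, |c k| ≤ 1) :
    ‖∑ k, c k • e k‖ ≤ 1 := by
  refine norm_le zero_le_one fun i => ?_
  rw [← coord_apply, map_sum]
  simp only [map_smul, coord_apply, e_apply, smul_eq_mul, mul_ite, mul_one, mul_zero]
  by_cases hi : i < m
  · rw [Finset.sum_eq_single (⟨i, hi⟩ : Fin m)]
    · simpa using hc _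
    · intro k _ hk
      rw [if_neg]
      rintro rfl
      exact hk rfl
    · simp
  · rw [Finset.sum_eq_zero]
    · simp
    · intro k _
      rw [if_neg]
      rintro rfl
      exact hi k.2

/-- The functional is tested on the vector of signs of its own coefficients. -/
theorem sum_abs_le_norm (φ : CZero →L[ℝ] ℝ) (m : ℕ) : ∑ k : Fin m, |φ (e k)| ≤ ‖φ‖ := by
  have h : ∑ k : Fin m, |φ (e k)| = φ (∑ k : Fin m, (SignType.sign (φ (e k)) : ℝ) • e k) := by
    simp [map_sum, sign_mul_self]
  rw [h]
  refine (le_abs_self _).trans ((φ.le_opNorm _).trans ?_)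
  refine mul_le_of_le_one_right (norm_nonneg _) (norm_sum_smul_e_le _ fun k => ?_)
  rcases SignType.sign (φ (e k)) with _ | _ | _ <;> simp

theorem sum_abs_sum_le (A : CZero →L[ℝ] CZero →L[ℝ] ℝ) (m n : ℕ) (ε : Fin m → Bool) :
    ∑ j : Fin n, |∑ k : Fin m, boolSign (ε k) * A (e k) (e j)| ≤ ‖A‖ := by
  have h := sum_abs_le_norm (A (∑ k : Fin m, boolSign (ε k) • e k)) n
  have hx := norm_sum_smul_e_le (fun k => boolSign (ε k)) (fun k => (abs_boolSign _).le)
  simp only [map_sum, map_smul, _root_.sum_apply, _root_.smul_apply,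
    smul_eq_mul] at h
  refine h.trans ?_
  have h2 := A.le_opNorm (∑ k : Fin m, boolSign (ε k) • e k)
  simp only [map_sum, map_smul] at h2
  exact h2.trans (mul_le_of_le_one_right (norm_nonneg _) hx)

/-- The form attaining equality. -/
noncomputable def extremalForm : CZero →L[ℝ] CZero →L[ℝ] ℝ :=
  (coord 0).smulRight (coord 0 + coord 1) + (coord 1).smulRight (coord 0 - coord 1)

theorem extremalForm_apply (x y : CZero) :
    extremalForm x y = x 0 * y 0 + x 0 * y 1 + x 1 * y 0 - x 1 * y 1 := by
  simp [extremalForm, coord_apply]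
  ring

theorem norm_extremalForm : ‖extremalForm‖ = 2 := by
  apply le_antisymm
  · refine ContinuousLinearMap.opNorm_le_bound₂ _ (by norm_num) fun x y => ?_
    rw [extremalForm_apply, Real.norm_eq_abs]
    have hx0 := abs_apply_le_norm x 0
    have hx1 := abs_apply_le_norm x 1
    have hy0 := abs_apply_le_norm y 0
    have hy1 := abs_apply_le_norm y 1
    -- The left side is twice the larger of |y 0| and |y 1|.
    have hsum : |y 0 + y 1| + |y 0 - y 1| ≤ 2 * ‖y‖ := by
      rw [abs_le] at hy0 hy1
      rcases abs_cases (y 0 + y 1) with h | h <;> rcases abs_cases (y 0 - y 1) with h' | h' <;>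
        linarith
    calc |x 0 * y 0 + x 0 * y 1 + x 1 * y 0 - x 1 * y 1|
        = |x 0 * (y 0 + y 1) + x 1 * (y 0 - y 1)| := by ring_nf
      _ ≤ |x 0| * |y 0 + y 1| + |x 1| * |y 0 - y 1| := by
          rw [← abs_mul, ← abs_mul]
          exact abs_add_le _ _
      _ ≤ ‖x‖ * |y 0 + y 1| + ‖x‖ * |y 0 - y 1| := by gcongr
      _ = ‖x‖ * (|y 0 + y 1| + |y 0 - y 1|) := by ring
      _ ≤ ‖x‖ * (2 * ‖y‖) := by gcongr
      _ = 2 * ‖x‖ * ‖y‖ := by ring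
  · have hn : ‖∑ k : Fin 2, (1 : ℝ) • e k‖ ≤ 1 := norm_sum_smul_e_le _ (by simp)
    have h := extremalForm.le_opNorm₂ (∑ k : Fin 2, (1 : ℝ) • e k) (∑ k : Fin 2, (1 : ℝ) • e k)
    have hv : extremalForm (∑ k : Fin 2, (1 : ℝ) • e k) (∑ k : Fin 2, (1 : ℝ) • e k) = 2 := by
      simp [Fin.sum_univ_two, extremalForm_apply, e_apply, add_apply]
      norm_num
    rw [hv, Real.norm_eq_abs, abs_two] at h
    calc (2 : ℝ) ≤ _ := h
      _ ≤ ‖extremalForm‖ * 1 * 1 := by gcongr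
      _ = ‖extremalForm‖ := by ring

end CZero

/-! ### The inequality on c₀ and its sharpness -/

theorem mixedSum_le {p q : ℝ} (hp1 : 1 ≤ p) (hp2 : p ≤ 2) (hq1 : 1 ≤ q) (hq2 : q ≤ 2)
    (hpq : 1 / p + 1 / q ≤ 3 / 2) (A : CZero →L[ℝ] CZero →L[ℝ] ℝ) :
    mixedSum p q A ≤ ENNReal.ofReal ((2 : ℝ) ^ (1 / p + 1 / q - 1) * ‖A‖) := by
  have hp : 0 < p := by linarith
  have hfin : ∀ m n : ℕ, ∑ k ∈ Finset.range m, (∑ j ∈ Finset.range n,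
      ENNReal.ofReal |A (CZero.e k) (CZero.e j)| ^ q) ^ (p / q) ≤
      ENNReal.ofReal ((2 : ℝ) ^ (1 / p + 1 / q - 1) * ‖A‖) ^ p := by
    intro m n
    simp only [Finset.sum_range]
    refine sum_mixed_le (fun (k : Fin m) (j : Fin n) => A (CZero.e k) (CZero.e j)) (norm_nonneg A)
      (fun ε => ?_) (fun ε => CZero.sum_abs_sum_le A m n ε) hp1 hp2 hq1 hq2 hpq
    simpa using CZero.sum_abs_sum_le A.flip n m ε
  rw [mixedSum, one_div p, ENNReal.rpow_inv_le_iff hp, ENNReal.tsum_eq_iSup_nat]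
  refine iSup_le fun m => ?_
  rw [← one_div p]
  -- With the number of rows fixed, the row length tends to infinity; the bound is uniform in both.
  have hlim : ∀ k, Filter.Tendsto (fun n => (∑ j ∈ Finset.range n,
      ENNReal.ofReal |A (CZero.e k) (CZero.e j)| ^ q) ^ (p / q)) Filter.atTop
      (nhds ((∑' j, ENNReal.ofReal |A (CZero.e k) (CZero.e j)| ^ q) ^ (p / q))) := fun k =>
    (ENNReal.continuous_rpow_const.tendsto _).comp (ENNReal.tendsto_nat_tsum _)
  exact le_of_tendsto' (tendsto_finsetSum (Finset.range m) fun k _ => hlim k) (hfin m)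

theorem mixedSum_extremalForm {p q : ℝ} (hp : 0 < p) (hq : 0 < q) :
    mixedSum p q CZero.extremalForm =
      ENNReal.ofReal ((2 : ℝ) ^ (1 / p + 1 / q - 1) * ‖CZero.extremalForm‖) := by
  have hpq : 0 < p / q := div_pos hp hq
  have hj : ∀ k ∈ Finset.range 2,
      ∑' j : ℕ, ENNReal.ofReal |CZero.extremalForm (CZero.e k) (CZero.e j)| ^ q = 2 := by
    intro k hk
    rw [tsum_eq_sum (s := Finset.range 2)]
    · rw [Finset.mem_range] at hk
      interval_cases k <;>
        simp [Finset.sum_range_succ, CZero.extremalForm_apply, CZero.e_apply] <;> norm_num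
    · intro j hj
      have h0 : 0 ≠ j := by rintro rfl; simp at hj
      have h1 : 1 ≠ j := by rintro rfl; simp at hj
      simp [CZero.extremalForm_apply, CZero.e_apply, h0, h1, hq]
  have hk : ∀ k ∉ Finset.range 2,
      (∑' j : ℕ, ENNReal.ofReal |CZero.extremalForm (CZero.e k) (CZero.e j)| ^ q) ^ (p / q) = 0 := by
    intro k hk
    have h0 : 0 ≠ k := by rintro rfl; simp at hk
    have h1 : 1 ≠ k := by rintro rfl; simp at hk
    simp [CZero.extremalForm_apply, CZero.e_apply, h0, h1, hq, hpq]
  rw [mixedSum, tsum_eq_sum hk, Finset.sum_congr rfl fun k hk => by rw [hj k hk],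
    CZero.norm_extremalForm, Finset.sum_const, Finset.card_range, nsmul_eq_mul]
  have h2 : (2 : ℝ≥0∞) = ENNReal.ofReal 2 := by simp
  rw [Nat.cast_ofNat, h2, ENNReal.ofReal_rpow_of_pos (by norm_num),
    ← ENNReal.ofReal_mul (by norm_num), ENNReal.ofReal_rpow_of_pos (by positivity)]
  congr 1
  rw [Real.mul_rpow (by norm_num) (by positivity), ← Real.rpow_mul (by norm_num),
    Real.rpow_sub_one (by norm_num), Real.rpow_add (by norm_num)]
  have : p / q * (1 / p) = 1 / q := by field_simp
  rw [this]
  ring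

/-- The inequality, the optimality of its constant, and the `2 × 2` form that attains it. -/
theorem theorem6p3 (p q : ℝ) (hp1 : 1 ≤ p) (hp2 : p ≤ 2) (hq1 : 1 ≤ q) (hq2 : q ≤ 2)
    (hpq : 1 / p + 1 / q ≤ 3 / 2) :
    (∀ A : CZero →L[ℝ] CZero →L[ℝ] ℝ,
      mixedSum p q A ≤ ENNReal.ofReal ((2 : ℝ) ^ (1 / p + 1 / q - 1) * ‖A‖)) ∧
    (∀ C : ℝ, (∀ A : CZero →L[ℝ] CZero →L[ℝ] ℝ, mixedSum p q A ≤ ENNReal.ofReal (C * ‖A‖)) →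
      (2 : ℝ) ^ (1 / p + 1 / q - 1) ≤ C) ∧
    (∃ A : CZero →L[ℝ] CZero →L[ℝ] ℝ,
      (∀ x y : CZero, A x y = x 0 * y 0 + x 0 * y 1 + x 1 * y 0 - x 1 * y 1) ∧
      ‖A‖ = 2 ∧
      mixedSum p q A = ENNReal.ofReal ((2 : ℝ) ^ (1 / p + 1 / q - 1) * ‖A‖)) := by
  have hp : 0 < p := by linarith
  have hq : 0 < q := by linarith
  have hext := mixedSum_extremalForm hp hq
  refine ⟨mixedSum_le hp1 hp2 hq1 hq2 hpq, fun C hC => ?_, CZero.extremalForm,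
    CZero.extremalForm_apply, CZero.norm_extremalForm, hext⟩
  have h := hC CZero.extremalForm
  rw [hext, CZero.norm_extremalForm, ENNReal.ofReal_le_ofReal_iff'] at h
  have hpos : 0 < (2 : ℝ) ^ (1 / p + 1 / q - 1) := by positivity
  -- Since `ENNReal.ofReal` truncates at 0, the second case says that the left side is nonpositive,
  -- which `hpos` excludes.
  rcases h with h | h <;> linarith
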